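/- Let $\mathcal A$ be a set containing two distinct elements $0$ and $1$, and for each $n$ let $X=X_n=(x_{ij})_{i,j=1}^n$ be a random $n\times n$ matrix whose entries are independent and identically distributed in $\mathcal A$, with a distribution that does not depend on $n$. Write $p_a=\mathbb P(x_{ij}=a)$, and assume $p_0>0$ and $p_1>0$. Put $Q=1/p_0$. A square matrix $(a_{ij})_{i,j=1}^m$ is triangular if $a_{ij}=0$ whenever $i<j$, and special triangular if moreover $a_{ii}=1$ for all $i$; it is permuted (special) triangular if it becomes (special) triangular after a permutation of its rows and a possibly different permutation of its columns. A submatrix is obtained by keeping a non-empty set of rows and a non-empty set of columns, in their original order. Let $T_n$, $T_n^{s}$, $T_n^{p}$, $T_n^{ps}$ be the maximal sizes $m$ of an $m\times m$ submatrix of $X_n$ that is, respectively, triangular, special triangular, permuted triangular, and permuted special triangular ($0$ if there is none). Then $Q>1$, and if $T_n^{x}$ is any of $T_n,T_n^{s},T_n^{p},T_n^{ps}$, then $$\frac{T_n^{x}}{\log_Q n}\xrightarrow{\ \mathrm p\ }2+\sqrt2\qquad(n\to\infty),$$ where $\xrightarrow{\mathrm p}$ denotes convergence in probability. Moreover, for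 every $n\times n$ matrix over the superboolean semiring $\{0,1,1^\nu\}$ (where $0$ is neutral for addition and absorbing for multiplication, a sum of two nonzero elements is $1^\nu$, $1$ is neutral for multiplication, and $1^\nu\cdot1^\nu=1^\nu$), the maximal size of a permuted special triangular submatrix equals the rank. Here the rank is the maximal number of independent columns, and columns are dependent if some linear combination of them with coefficients in $\{0,1\}$, not all $0$, has all its entries in $\{0,1^\nu\}$. In particular, $T_n^{ps}$ is the rank of $X_n$ when $\mathcal A=\{0,1,1^\nu\}$. -/

import Mathlib

open MeasureTheory ProbabilityTheory Filter Topology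

/-! Triangular matrices and their permutations. -/

section Triangular

variable {𝒜 : Type*} [Zero 𝒜] [One 𝒜]

/-- A square matrix is (lower) triangular if all entries strictly above the diagonal are `0`. -/
def IsTriangular (m : ℕ) (B : Matrix (Fin m) (Fin m) 𝒜) : Prop :=
  ∀ i j, i < j → B i j = 0

/-- A square matrix is special triangular if all entries strictly above the diagonal are `0`
and all diagonal entries are `1`. -/
def IsSpecialTriangular (m : ℕ) (B : Matrix (Fin m) (Fin m) 𝒜) : Prop :=
  (∀ i j, i < j → B i j = 0) ∧ ∀ i, B i i = 1

/-- `B` is, up to a permutation of its rows and a (possibly different) permutation of its columns,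
a triangular matrix. -/
def IsPermutedTriangular (m : ℕ) (B : Matrix (Fin m) (Fin m) 𝒜) : Prop :=
  ∃ σ τ : Equiv.Perm (Fin m), IsTriangular m (B.submatrix σ τ)

/-- `B` is, up to a permutation of its rows and a (possibly different) permutation of its columns,
a special triangular matrix. -/
def IsPermutedSpecialTriangular (m : ℕ) (B : Matrix (Fin m) (Fin m) 𝒜) : Prop :=
  ∃ σ τ : Equiv.Perm (Fin m), IsSpecialTriangular m (B.submatrix σ τ)

end Triangular

/-- The maximal size `m` of a (non-empty, square) submatrix of `A` that has the property `P`.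
The rows and columns of a submatrix keep their order. The value is `0` if there is no such
submatrix; the sizes are bounded by `n`. -/
noncomputable def maxSubmatrixSize {𝒜 : Type*} {n : ℕ}
    (P : (m : ℕ) → Matrix (Fin m) (Fin m) 𝒜 → Prop) (A : Matrix (Fin n) (Fin n) 𝒜) : ℕ :=
  sSup {m : ℕ | 0 < m ∧ ∃ r c : Fin m ↪o Fin n, P m (A.submatrix r c)}

/-- Convergence in probability to the constant `c`, for random variables `Y n` that may live on
different probability spaces. -/
def TendstoInProbability {Ω : ℕ → Type*} [∀ n, MeasurableSpace (Ω n)]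
    (Pr : ∀ n, Measure (Ω n)) (Y : ∀ n, Ω n → ℝ) (c : ℝ) : Prop :=
  ∀ ε : ℝ, 0 < ε → Tendsto (fun n => Pr n {ω | ε ≤ |Y n ω - c|}) atTop (𝓝 0)

/-! The superboolean semiring and the rank of superboolean matrices. -/

/-- The superboolean semiring `{0, 1, 1^ν}`; the third element is called `ghost`. -/
inductive SuperBoolean : Type
  | zero
  | one
  | ghost

namespace SuperBoolean

instance : Zero SuperBoolean := ⟨zero⟩

instance : One SuperBoolean := ⟨one⟩

/-- `0` is neutral, and any sum of two nonzero elements is `1^ν` (in particular `1 + 1 = 1^ν`). -/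
instance : Add SuperBoolean :=
  ⟨fun a b => match a, b with
    | zero, b => b
    | a, zero => a
    | _, _ => ghost⟩

/-- `0` is absorbing, `1` is neutral, and `1^ν * 1^ν = 1^ν`. -/
instance : Mul SuperBoolean :=
  ⟨fun a b => match a, b with
    | zero, _ => zero
    | _, zero => zero
    | one, b => b
    | ghost, _ => ghost⟩

instance : CommSemiring SuperBoolean where
  add_assoc a b c := by cases a <;> cases b <;> cases c <;> rfl
  zero_add a := by cases a <;> rfl
  add_zero a := by cases a <;> rfl
  add_comm a b := by cases a <;> cases b <;> rfl
  mul_assoc a b c := by cases a <;> cases b <;> cases c <;> rfl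
  one_mul a := by cases a <;> rfl
  mul_one a := by cases a <;> rfl
  mul_comm a b := by cases a <;> cases b <;> rfl
  zero_mul a := by cases a <;> rfl
  mul_zero a := by cases a <;> rfl
  left_distrib a b c := by cases a <;> cases b <;> cases c <;> rfl
  right_distrib a b c := by cases a <;> cases b <;> cases c <;> rfl
  nsmul := nsmulRec

/-- The columns of `A` with index in `J` are dependent if some combination of them, with
coefficients in `{0, 1}` that are not all `0`, has all its entries in the ghost ideal `{0, 1^ν}`. -/
def ColumnsDependent {m n : ℕ} (A : Matrix (Fin m) (Fin n) SuperBoolean)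
    (J : Finset (Fin n)) : Prop :=
  ∃ a : Fin n → SuperBoolean, (∀ j ∈ J, a j = 0 ∨ a j = 1) ∧ (∃ j ∈ J, a j ≠ 0) ∧
    ∀ i, ∑ j ∈ J, a j * A i j = 0 ∨ ∑ j ∈ J, a j * A i j = ghost

/-- The rank of a superboolean matrix: the maximal number of independent columns. -/
noncomputable def rank {m n : ℕ} (A : Matrix (Fin m) (Fin n) SuperBoolean) : ℕ :=
  sSup {k : ℕ | ∃ J : Finset (Fin n), J.card = k ∧ ¬ ColumnsDependent A J}

end SuperBoolean

/-!
Write `L = log_Q n`. All four sizes lie between the special triangular size and the permuted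
triangular size, so an upper tail for the latter and a lower tail for the former suffice.

*Upper tail.* The expected number of triangular arrays of size `m = y L`, with rows and columns
in any order, is about `Q ^ ((2 y - y² / 2) L²)`, which would only give `y ≤ 4`. The last rows and
the first columns of a triangular array have few prescribed zeros, and a line with fewer than `L`
of them inflates the expectation: it can be chosen in `n` ways, while its zeros have probability
above `1 / n`. Dropping the last `L` rows and the first `L` columns improves the exponent to
`-(y² / 2 - 2 y + 1) L²`, which is negative for `y > 2 + √2`
(`measureReal_le_maxSubmatrixSize_permuted_le`, `upper_exponent_le`).

*Lower tail.* Split the indices into `m = x L` blocks and choose one row and one column from each,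
so that the order is automatic and two choices can share entries only at equal positions. In the
second moment, two choices that agree in the rows `A` and the columns `B` contribute
`N ^ (-|A| - |B|)`, where `N` is the block length, times `Q ^ z` with `z` the number of positions
above the diagonal in `A × B`; diagonal entries and the number of sets `A`, `B` change this only on
a smaller scale. For given sizes `z` is largest when `A` consists of the first rows and `B` of the
last columns (`card_lt_product_le`), and then the total exponent is negative for all nonempty
`A`, `B` as long as `x < 2 + √2` (`lower_exponent_le`): the critical sets are again those in which
`L` rows and `L` columns are missing. Hence the relative variance tends to `0`
(`measureReal_maxSubmatrixSize_special_lt_le`).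

*Rank.* A sum in the superboolean semiring equals `1` only if exactly one summand is nonzero and
that summand is `1`. So independent columns possess a row that is `1` in one of them and `0` in
the others, and removing this column repeatedly produces a special triangular array. Conversely,
in a combination of the columns of such an array, the row of the first column with coefficient `1`
has the sum `1`.
-/

/-! ### Maximal submatrices and injective selections of rows and columns -/

section MaxSize

variable {𝒜 : Type*} {n : ℕ} {P P' : (m : ℕ) → Matrix (Fin m) (Fin m) 𝒜 → Prop}
  {A : Matrix (Fin n) (Fin n) 𝒜}

theorem bddAbove_submatrixSizes :
    BddAbove {m : ℕ | 0 < m ∧ ∃ r c : Fin m ↪o Fin n, P m (A.submatrix r c)} := by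
  refine ⟨n, ?_⟩
  rintro m ⟨-, r, -, -⟩
  simpa using Fintype.card_le_of_injective r r.injective

theorem le_maxSubmatrixSize {m : ℕ} (r c : Fin m ↪o Fin n) (h : P m (A.submatrix r c)) :
    m ≤ maxSubmatrixSize P A := by
  rcases Nat.eq_zero_or_pos m with rfl | hm
  · exact Nat.zero_le _
  · exact le_csSup bddAbove_submatrixSizes ⟨hm, r, c, h⟩

theorem exists_of_maxSubmatrixSize_pos (h : 0 < maxSubmatrixSize P A) :
    ∃ r c : Fin (maxSubmatrixSize P A) ↪o Fin n, P _ (A.submatrix r c) := by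
  have hne : {m : ℕ | 0 < m ∧ ∃ r c : Fin m ↪o Fin n, P m (A.submatrix r c)}.Nonempty := by
    by_contra hemp
    rw [Set.not_nonempty_iff_eq_empty] at hemp
    simp [maxSubmatrixSize, hemp] at h
  exact (Nat.sSup_mem hne bddAbove_submatrixSizes).2

theorem maxSubmatrixSize_mono (h : ∀ m B, P m B → P' m B) :
    maxSubmatrixSize P A ≤ maxSubmatrixSize P' A := by
  rcases Nat.eq_zero_or_pos (maxSubmatrixSize P A) with h0 | h0
  · omega
  · obtain ⟨r, c, hrc⟩ := exists_of_maxSubmatrixSize_pos h0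
    exact le_maxSubmatrixSize r c (h _ _ hrc)

/-- Sorting an injective selection of indices turns it into an order embedding. -/
theorem exists_orderEmbedding_comp_perm {m : ℕ} {f : Fin m → Fin n}
    (hf : Function.Injective f) :
    ∃ (g : Fin m ↪o Fin n) (σ : Equiv.Perm (Fin m)), ∀ i, g (σ i) = f i := by
  have hs : StrictMono (f ∘ Tuple.sort f) :=
    (Tuple.monotone_sort f).strictMono_of_injective (hf.comp (Tuple.sort f).injective)
  exact ⟨OrderEmbedding.ofStrictMono _ hs, (Tuple.sort f)⁻¹, fun i => by simp⟩

variable [Zero 𝒜] [One 𝒜]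

theorem IsSpecialTriangular.isTriangular {m : ℕ} {B : Matrix (Fin m) (Fin m) 𝒜}
    (h : IsSpecialTriangular m B) : IsTriangular m B := h.1

omit [One 𝒜] in
theorem IsTriangular.isPermutedTriangular {m : ℕ} {B : Matrix (Fin m) (Fin m) 𝒜}
    (h : IsTriangular m B) : IsPermutedTriangular m B := ⟨1, 1, h⟩

theorem IsSpecialTriangular.isPermutedSpecialTriangular {m : ℕ}
    {B : Matrix (Fin m) (Fin m) 𝒜} (h : IsSpecialTriangular m B) :
    IsPermutedSpecialTriangular m B := ⟨1, 1, h⟩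

theorem IsPermutedSpecialTriangular.isPermutedTriangular {m : ℕ}
    {B : Matrix (Fin m) (Fin m) 𝒜} (h : IsPermutedSpecialTriangular m B) :
    IsPermutedTriangular m B := by
  obtain ⟨σ, τ, h⟩ := h
  exact ⟨σ, τ, h.1⟩

/-- A special triangular array on injectively chosen rows and columns, in any order, is a
permuted special triangular submatrix. -/
theorem le_maxSubmatrixSize_permutedSpecial {m : ℕ} {r c : Fin m → Fin n}
    (hr : Function.Injective r) (hc : Function.Injective c)
    (h : IsSpecialTriangular m (A.submatrix r c)) :
    m ≤ maxSubmatrixSize IsPermutedSpecialTriangular A := by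
  obtain ⟨r', σ, hr'⟩ := exists_orderEmbedding_comp_perm hr
  obtain ⟨c', τ, hc'⟩ := exists_orderEmbedding_comp_perm hc
  refine le_maxSubmatrixSize r' c' ⟨σ, τ, ?_⟩
  simpa [IsSpecialTriangular, hr', hc'] using h

end MaxSize

/-! ### Rank of superboolean matrices -/

namespace SuperBoolean

theorem zero_ne_one' : (0 : SuperBoolean) ≠ 1 := nofun

theorem one_ne_ghost : (1 : SuperBoolean) ≠ ghost := nofun

theorem eq_one_of_ne {x : SuperBoolean} (h0 : x ≠ 0) (hg : x ≠ ghost) : x = 1 := by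
  cases x
  · exact absurd rfl h0
  · rfl
  · exact absurd rfl hg

theorem add_eq_one {x y : SuperBoolean} (h : x + y = 1) :
    (x = 1 ∧ y = 0) ∨ (x = 0 ∧ y = 1) := by
  cases x <;> cases y <;> first | exact Or.inl ⟨rfl, rfl⟩ | exact Or.inr ⟨rfl, rfl⟩ | cases h

theorem add_eq_zero {x y : SuperBoolean} (h : x + y = 0) : x = 0 ∧ y = 0 := by
  cases x <;> cases y <;> first | exact ⟨rfl, rfl⟩ | cases h

theorem sum_eq_zero_imp {ι : Type*} {s : Finset ι} {f : ι → SuperBoolean}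
    (h : ∑ j ∈ s, f j = 0) : ∀ j ∈ s, f j = 0 := by
  classical
  induction s using Finset.induction_on with
  | empty => simp
  | insert a s ha ih =>
    rw [Finset.sum_insert ha] at h
    obtain ⟨h1, h2⟩ := add_eq_zero h
    simpa [h1] using ih h2

/-- A sum equal to `1` has exactly one nonzero summand, and this summand is `1`. -/
theorem sum_eq_one_imp {ι : Type*} {s : Finset ι} {f : ι → SuperBoolean}
    (h : ∑ j ∈ s, f j = 1) : ∃ k ∈ s, f k = 1 ∧ ∀ j ∈ s, j ≠ k → f j = 0 := by
  classical
  induction s using Finset.induction_on with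
  | empty => exact absurd h zero_ne_one'
  | insert a s ha ih =>
    rw [Finset.sum_insert ha] at h
    rcases add_eq_one h with ⟨h1, h2⟩ | ⟨h1, h2⟩
    · refine ⟨a, Finset.mem_insert_self _ _, h1, fun j hj hja => ?_⟩
      exact sum_eq_zero_imp h2 j (Finset.mem_of_mem_insert_of_ne hj hja)
    · obtain ⟨k, hk, hk1, hk2⟩ := ih h2
      refine ⟨k, Finset.mem_insert_of_mem hk, hk1, fun j hj hjk => ?_⟩
      rcases Finset.mem_insert.1 hj with rfl | hj
      · exact h1
      · exact hk2 j hj hjk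

variable {m n : ℕ} {A : Matrix (Fin m) (Fin n) SuperBoolean}

theorem ColumnsDependent.mono {I J : Finset (Fin n)} (hIJ : I ⊆ J) (h : ColumnsDependent A I) :
    ColumnsDependent A J := by
  classical
  obtain ⟨a, ha, ⟨j, hj, hj0⟩, hs⟩ := h
  refine ⟨fun j => if j ∈ I then a j else 0, fun j _ => ?_, ⟨j, hIJ hj, by simpa [hj] using hj0⟩,
    fun i => ?_⟩
  · by_cases hj : j ∈ I
    · simpa [hj] using ha j hj
    · simp [hj]
  · have : ∑ j ∈ J, (if j ∈ I then a j else 0) * A i j = ∑ j ∈ I, a j * A i j := by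
      rw [← Finset.sum_subset hIJ]
      · exact Finset.sum_congr rfl fun j hj => by simp [hj]
      · intro j _ hj
        simp [hj]
    rw [this]
    exact hs i

/-- Independent columns have a row in which exactly one of them has a nonzero entry, and this
entry is `1`. -/
theorem exists_row_of_not_columnsDependent {J : Finset (Fin n)} (hJ : J.Nonempty)
    (h : ¬ ColumnsDependent A J) :
    ∃ i, ∃ k ∈ J, A i k = 1 ∧ ∀ j ∈ J, j ≠ k → A i j = 0 := by
  by_contra hcon
  refine h ⟨fun _ => 1, fun _ _ => Or.inr rfl, ?_, fun i => ?_⟩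
  · obtain ⟨j, hj⟩ := hJ
    exact ⟨j, hj, zero_ne_one'.symm⟩
  · by_contra hs
    push Not at hs
    have h1 := eq_one_of_ne hs.1 hs.2
    simp only [one_mul] at h1
    exact hcon ⟨i, sum_eq_one_imp h1⟩

/-- Independent columns carry a special triangular array: peel off one column at a time. -/
theorem exists_triangular_of_not_columnsDependent (k : ℕ) (J : Finset (Fin n))
    (hk : J.card = k) (h : ¬ ColumnsDependent A J) :
    ∃ (r : Fin k → Fin m) (c : Fin k → Fin n), (∀ i, c i ∈ J) ∧
      IsSpecialTriangular k (A.submatrix r c) := by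
  classical
  induction k generalizing J with
  | zero => exact ⟨Fin.elim0, Fin.elim0, fun i => i.elim0, fun i => i.elim0, fun i => i.elim0⟩
  | succ k ih =>
    have hJ : J.Nonempty := Finset.card_pos.1 (by omega)
    obtain ⟨i₀, j₀, hj₀, h1, h0⟩ := exists_row_of_not_columnsDependent hJ h
    obtain ⟨r, c, hc, ht, hd⟩ := ih (J.erase j₀) (by rw [Finset.card_erase_of_mem hj₀]; omega)
      (fun hdep => h (hdep.mono (Finset.erase_subset _ _)))
    refine ⟨Fin.cons i₀ r, Fin.cons j₀ c, fun i => ?_, fun i j hij => ?_, fun i => ?_⟩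
    · refine Fin.cases ?_ (fun i => ?_) i
      · simpa using hj₀
      · simpa using Finset.mem_of_mem_erase (hc i)
    · induction j using Fin.cases with
      | zero => exact absurd hij (Fin.not_lt_zero i)
      | succ j =>
        induction i using Fin.cases with
        | zero =>
          have := hc j
          rw [Finset.mem_erase] at this
          simpa using h0 _ this.2 this.1
        | succ i => simpa using ht i j (by simpa using hij)
    · induction i using Fin.cases with
      | zero => simpa using h1
      | succ i => simpa using hd i

/-- The columns of a special triangular array are independent: in a combination, the row of the
first column with coefficient `1` has the sum `1`. -/
theorem not_columnsDependent_of_triangular {k : ℕ} {r : Fin k → Fin m} {c : Fin k → Fin n}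
    (hc : Function.Injective c) (h : IsSpecialTriangular k (A.submatrix r c)) :
    ¬ ColumnsDependent A (Finset.univ.map ⟨c, hc⟩) := by
  classical
  rintro ⟨a, ha, ⟨j, hj, hj0⟩, hs⟩
  simp only [Finset.mem_map, Finset.mem_univ, true_and, Function.Embedding.coeFn_mk,
    forall_exists_index, forall_apply_eq_imp_iff] at ha hj
  obtain ⟨i, rfl⟩ := hj
  have hne : (Finset.univ.filter fun i => a (c i) ≠ 0).Nonempty := ⟨i, by simpa using hj0⟩
  obtain ⟨i, hi, hmin⟩ := Finset.exists_min_image _ id hne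
  simp only [Finset.mem_filter, Finset.mem_univ, true_and, id] at hi hmin
  have hsum := hs (r i)
  rw [Finset.sum_map, Finset.sum_eq_single i] at hsum
  · have hd : A (r i) (c i) = 1 := h.2 i
    simp only [Function.Embedding.coeFn_mk, hd, (ha i).resolve_left hi, mul_one] at hsum
    exact hsum.elim zero_ne_one'.symm one_ne_ghost
  · intro j _ hji
    simp only [Function.Embedding.coeFn_mk]
    rcases lt_or_gt_of_ne hji with hlt | hlt
    · have : a (c j) = 0 := by
        by_contra hcon
        exact absurd (hmin j hcon) (not_le.2 hlt)
      rw [this, zero_mul]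
    · rw [show A (r i) (c j) = 0 from h.1 i j hlt, mul_zero]
  · simp

/-- Rows and columns of a special triangular array are automatically distinct. -/
theorem injective_of_isSpecialTriangular {k : ℕ} {r : Fin k → Fin m} {c : Fin k → Fin n}
    (h : IsSpecialTriangular k (A.submatrix r c)) :
    Function.Injective r ∧ Function.Injective c := by
  have hd : ∀ i, A (r i) (c i) = 1 := h.2
  have h0 : ∀ i j, i < j → A (r i) (c j) = 0 := h.1
  constructor
  · intro i j hij
    rcases lt_trichotomy i j with hlt | heq | hlt
    · exact absurd ((h0 i j hlt).symm.trans (hij ▸ hd j)) zero_ne_one'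
    · exact heq
    · exact absurd ((h0 j i hlt).symm.trans (hij ▸ hd i)) zero_ne_one'
  · intro i j hij
    rcases lt_trichotomy i j with hlt | heq | hlt
    · exact absurd ((h0 i j hlt).symm.trans (hij ▸ hd i)) zero_ne_one'
    · exact heq
    · exact absurd ((h0 j i hlt).symm.trans (hij ▸ hd j)) zero_ne_one'

theorem rank_eq_maxSubmatrixSize (A : Matrix (Fin n) (Fin n) SuperBoolean) :
    rank A = maxSubmatrixSize IsPermutedSpecialTriangular A := by
  have hbdd : BddAbove {k : ℕ | ∃ J : Finset (Fin n), J.card = k ∧ ¬ ColumnsDependent A J} := by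
    refine ⟨n, ?_⟩
    rintro k ⟨J, rfl, -⟩
    simpa using J.card_le_univ
  apply le_antisymm
  · refine csSup_le ⟨0, ∅, rfl, ?_⟩ ?_
    · rintro ⟨a, -, ⟨j, hj, -⟩, -⟩
      exact absurd hj (Finset.notMem_empty j)
    · rintro k ⟨J, hk, hJ⟩
      obtain ⟨r, c, -, h⟩ := exists_triangular_of_not_columnsDependent k J hk hJ
      obtain ⟨hr, hc⟩ := injective_of_isSpecialTriangular h
      exact le_maxSubmatrixSize_permutedSpecial hr hc h
  · rcases Nat.eq_zero_or_pos (maxSubmatrixSize IsPermutedSpecialTriangular A) with h0 | h0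
    · omega
    · obtain ⟨r, c, σ, τ, h⟩ := exists_of_maxSubmatrixSize_pos h0
      rw [Matrix.submatrix_submatrix] at h
      refine le_csSup hbdd ⟨_, ?_, not_columnsDependent_of_triangular
        (c.injective.comp τ.injective) h⟩
      simp

end SuperBoolean

/-! ### First and second moments for prescribed entries -/

section Moments

variable {Ω 𝒜 κ : Type*} [MeasurableSpace Ω] [MeasurableSpace 𝒜]
  {μ : Measure 𝒜} {P : Measure Ω} {Y : κ → Ω → 𝒜}

/-- The event that the entries with index in `S` take the values prescribed by `t`. -/
def agreeEvent (Y : κ → Ω → 𝒜) (t : κ → 𝒜) (S : Finset κ) : Set Ω :=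
  {ω | ∀ e ∈ S, Y e ω = t e}

omit [MeasurableSpace Ω] [MeasurableSpace 𝒜] in
theorem agreeEvent_eq_iInter (t : κ → 𝒜) (S : Finset κ) :
    agreeEvent Y t S = ⋂ e ∈ S, Y e ⁻¹' {t e} := by
  ext ω
  simp [agreeEvent]

omit [MeasurableSpace Ω] [MeasurableSpace 𝒜] in
theorem agreeEvent_inter [DecidableEq κ] (t : κ → 𝒜) (S T : Finset κ) :
    agreeEvent Y t S ∩ agreeEvent Y t T = agreeEvent Y t (S ∪ T) := by
  ext ω
  simp only [agreeEvent, Set.mem_inter_iff, Set.mem_ofPred_eq, Finset.mem_union]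
  exact ⟨fun h e he => he.elim (h.1 e) (h.2 e),
    fun h => ⟨fun e he => h e (Or.inl he), fun e he => h e (Or.inr he)⟩⟩

theorem nullMeasurableSet_agreeEvent [MeasurableSingletonClass 𝒜]
    (hlaw : ∀ e, HasLaw (Y e) μ P) (t : κ → 𝒜) (S : Finset κ) :
    NullMeasurableSet (agreeEvent Y t S) P := by
  rw [agreeEvent_eq_iInter]
  exact Finset.nullMeasurableSet_biInter S fun e _ =>
    (hlaw e).aemeasurable.nullMeasurableSet_preimage (measurableSet_singleton _)

theorem measureReal_agreeEvent [MeasurableSingletonClass 𝒜]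
    (hlaw : ∀ e, HasLaw (Y e) μ P) (hind : iIndepFun Y P) (t : κ → 𝒜) (S : Finset κ) :
    P.real (agreeEvent Y t S) = ∏ e ∈ S, μ.real {t e} := by
  rw [agreeEvent_eq_iInter, measureReal_def,
    hind.measure_inter_preimage_eq_mul S (sets := fun e => {t e})
      fun e _ => measurableSet_singleton _, ENNReal.toReal_prod]
  refine Finset.prod_congr rfl fun e _ => ?_
  rw [measureReal_def, ← (hlaw e).map_eq,
    Measure.map_apply_of_aemeasurable (hlaw e).aemeasurable (measurableSet_singleton _)]

/-- **Second moment method.** For finitely many events of the same probability `w`, the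
probability that none of them occurs is controlled by the sum of the covariances. -/
theorem sq_mul_measureReal_forall_notMem_le [IsProbabilityMeasure P] {ι : Type*} [Fintype ι]
    (E : ι → Set Ω) (hE : ∀ α, NullMeasurableSet (E α) P) (w : ℝ) (hw : ∀ α, P.real (E α) = w) :
    (Fintype.card ι * w) ^ 2 * P.real {ω | ∀ α, ω ∉ E α} ≤
      ∑ α, ∑ β, (P.real (E α ∩ E β) - w ^ 2) := by
  classical
  set I : ι → Ω → ℝ := fun α => (E α).indicator fun _ => 1 with hI
  have hint : ∀ F : Set Ω, NullMeasurableSet F P →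
      Integrable (F.indicator fun _ => (1 : ℝ)) P := fun F hF =>
    (integrable_const (1 : ℝ)).indicator₀ hF
  have hval : ∀ F : Set Ω, NullMeasurableSet F P →
      ∫ ω, F.indicator (fun _ => (1 : ℝ)) ω ∂P = P.real F := fun F hF => by
    rw [integral_indicator₀ hF]
    simp
  have hprod : ∀ α β ω, (I α ω - w) * (I β ω - w) =
      (E α ∩ E β).indicator (fun _ => (1 : ℝ)) ω - w * I α ω - w * I β ω + w ^ 2 := by
    intro α β ω
    by_cases ha : ω ∈ E α <;> by_cases hb : ω ∈ E β <;> simp [hI, ha, hb] <;> ring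
  have hsq : ∀ ω, (∑ α, (I α ω - w)) ^ 2 = ∑ α, ∑ β,
      ((E α ∩ E β).indicator (fun _ => (1 : ℝ)) ω - w * I α ω - w * I β ω + w ^ 2) := by
    intro ω
    rw [sq, Finset.sum_mul_sum]
    exact Finset.sum_congr rfl fun α _ => Finset.sum_congr rfl fun β _ => hprod α β ω
  have hterm : ∀ α β, Integrable (fun ω =>
      (E α ∩ E β).indicator (fun _ => (1 : ℝ)) ω - w * I α ω - w * I β ω + w ^ 2) P := by
    intro α β
    exact (((hint _ ((hE α).inter (hE β))).sub ((hint _ (hE α)).const_mul w)).sub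
      ((hint _ (hE β)).const_mul w)).add (integrable_const _)
  have hZ : Integrable (fun ω => (∑ α, (I α ω - w)) ^ 2) P := by
    simp_rw [hsq]
    exact integrable_finsetSum _ fun α _ => integrable_finsetSum _ fun β _ => hterm α β
  have hmarkov := mul_meas_ge_le_integral_of_nonneg (μ := P)
    (f := fun ω => (∑ α, (I α ω - w)) ^ 2) (ae_of_all _ fun ω => sq_nonneg _) hZ
    ((Fintype.card ι * w) ^ 2)
  have hval2 : ∫ ω, (∑ α, (I α ω - w)) ^ 2 ∂P = ∑ α, ∑ β, (P.real (E α ∩ E β) - w ^ 2) := by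
    simp_rw [hsq]
    rw [integral_finsetSum _ fun α _ => integrable_finsetSum _ fun β _ => hterm α β]
    refine Finset.sum_congr rfl fun α _ => ?_
    rw [integral_finsetSum _ fun β _ => hterm α β]
    refine Finset.sum_congr rfl fun β _ => ?_
    have i1 := hint _ ((hE α).inter (hE β))
    have i2 : Integrable (fun ω => w * I α ω) P := (hint _ (hE α)).const_mul w
    have i3 : Integrable (fun ω => w * I β ω) P := (hint _ (hE β)).const_mul w
    have e1 : ∫ ω, I α ω ∂P = w := (hval _ (hE α)).trans (hw α)
    have e2 : ∫ ω, I β ω ∂P = w := (hval _ (hE β)).trans (hw β)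
    have i12 : Integrable (fun ω => (E α ∩ E β).indicator (fun _ => (1 : ℝ)) ω - w * I α ω) P :=
      i1.sub i2
    have i123 : Integrable (fun ω =>
        (E α ∩ E β).indicator (fun _ => (1 : ℝ)) ω - w * I α ω - w * I β ω) P := i12.sub i3
    rw [integral_add i123 (integrable_const _), integral_sub i12 i3, integral_sub i1 i2,
      integral_const_mul, integral_const_mul, hval _ ((hE α).inter (hE β)), e1, e2,
      integral_const, probReal_univ, one_smul]
    ring
  rw [hval2] at hmarkov
  refine le_trans (mul_le_mul_of_nonneg_left (measureReal_mono ?_) (sq_nonneg _)) hmarkov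
  intro ω hω
  have : ∀ α, I α ω = 0 := fun α => by simpa [hI] using hω α
  simp [this]

end Moments

/-! ### Counting positions in triangular arrays -/

section Counting

/-- Sums of an antitone function over `a` indices are largest over the first `a` of them. -/
theorem sum_le_sum_range_of_antitone {m : ℕ} (A : Finset (Fin m)) {h : ℕ → ℕ} (hh : Antitone h) :
    ∑ i ∈ A, h i ≤ ∑ k ∈ Finset.range A.card, h k := by
  have key : ∀ k : Fin A.card, (k : ℕ) ≤ A.orderEmbOfFin rfl k := by
    rintro ⟨k, hk⟩
    induction k with
    | zero => exact Nat.zero_le _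
    | succ k ih =>
      have h1 := ih (by omega)
      have h2 : A.orderEmbOfFin rfl ⟨k, by omega⟩ < A.orderEmbOfFin rfl ⟨k + 1, hk⟩ :=
        (A.orderEmbOfFin rfl).strictMono (by simp [Fin.lt_def])
      have h3 := Fin.lt_def.1 h2
      simp only at h1 ⊢
      omega
  calc ∑ i ∈ A, h i = ∑ k : Fin A.card, h (A.orderEmbOfFin rfl k) := by
        conv_lhs => rw [← Finset.map_orderEmbOfFin_univ A rfl]
        rw [Finset.sum_map]
        rfl
    _ ≤ ∑ k : Fin A.card, h k := Finset.sum_le_sum fun k _ => hh (key k)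
    _ = _ := Fin.sum_univ_eq_sum_range h A.card

/-- The number of positions strictly above the diagonal in a block `A × B` is largest when `A`
consists of the first rows. -/
theorem card_lt_product_le {m : ℕ} (A B : Finset (Fin m)) :
    ((A ×ˢ B).filter fun p => p.1 < p.2).card ≤
      ∑ k ∈ Finset.range A.card, min B.card (m - 1 - k) := by
  classical
  have h1 : ((A ×ˢ B).filter fun p => p.1 < p.2).card =
      ∑ i ∈ A, (B.filter fun j => i < j).card := by
    rw [Finset.card_filter, Finset.sum_product]
    simp_rw [Finset.card_filter]
  rw [h1]
  refine le_trans (Finset.sum_le_sum (g := fun i : Fin m => min B.card (m - 1 - (i : ℕ)))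
    fun i _ => le_min (Finset.card_filter_le _ _) ?_)
    (sum_le_sum_range_of_antitone A (h := fun k => min B.card (m - 1 - k)) ?_)
  · calc (B.filter fun j => i < j).card ≤ (Finset.Ioi i).card :=
        Finset.card_le_card fun j hj => Finset.mem_Ioi.2 (Finset.mem_filter.1 hj).2
      _ = m - 1 - i := Fin.card_Ioi i
  · intro k l hkl
    simp only
    omega

/-- Closed form of the bound `card_lt_product_le` when the blocks are large. -/
theorem two_mul_sum_min_le {m a b : ℕ} (ha : a ≤ m) (hb : b ≤ m) (hab : m ≤ a + b) :
    2 * ((∑ k ∈ Finset.range a, min b (m - 1 - k) : ℕ) : ℝ) ≤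
      2 * m * b - b ^ 2 - (m - a) ^ 2 := by
  obtain ⟨c, rfl⟩ : ∃ c, a = (m - b) + c := ⟨a - (m - b), by omega⟩
  clear hab
  induction c with
  | zero =>
    have : (∑ k ∈ Finset.range (m - b + 0), min b (m - 1 - k)) ≤ (m - b) * b := by
      calc _ ≤ ∑ k ∈ Finset.range (m - b + 0), b := Finset.sum_le_sum fun k _ => min_le_left _ _
        _ = _ := by simp
    have h2 : ((∑ k ∈ Finset.range (m - b + 0), min b (m - 1 - k) : ℕ) : ℝ) ≤
        ((m - b : ℕ) : ℝ) * b := by exact_mod_cast this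
    rw [Nat.cast_sub hb] at h2
    have h3 : ((m - b + 0 : ℕ) : ℝ) = m - b := by rw [Nat.add_zero, Nat.cast_sub hb]
    rw [h3]
    nlinarith
  | succ c ih =>
    have h1 := ih (by omega)
    rw [← Nat.add_assoc, Finset.sum_range_succ, Nat.cast_add]
    have h2 : ((min b (m - 1 - (m - b + c)) : ℕ) : ℝ) ≤ m - 1 - ((m - b + c : ℕ) : ℝ) := by
      have : min b (m - 1 - (m - b + c)) + 1 + (m - b + c) ≤ m := by omega
      have : ((min b (m - 1 - (m - b + c)) + 1 + (m - b + c) : ℕ) : ℝ) ≤ m := by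
        exact_mod_cast this
      push_cast at this ⊢
      linarith
    push_cast at h1 h2 ⊢
    nlinarith

theorem sum_min_le_mul (m a b : ℕ) : ∑ k ∈ Finset.range a, min b (m - 1 - k) ≤ a * b := by
  calc _ ≤ ∑ k ∈ Finset.range a, b := Finset.sum_le_sum fun k _ => min_le_left _ _
    _ = _ := by simp

/-- The number of positions `(i, j)` with `i < j + k` in a square of side `d`, bounded below by
counting the complementary triangle. -/
theorem two_mul_sq_le_card (d k : ℕ) (hk : k ≤ d) :
    2 * d ^ 2 ≤ 2 * ((Finset.univ : Finset (Fin d × Fin d)).filter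
      fun p => (p.1 : ℕ) < p.2 + k).card + (d - k) * (d - k + 1) := by
  classical
  have htot := Finset.card_filter_add_card_filter_not (s := (Finset.univ : Finset (Fin d × Fin d)))
    (fun p => (p.1 : ℕ) < p.2 + k)
  have hcompl : ((Finset.univ : Finset (Fin d × Fin d)).filter
      fun p => ¬ (p.1 : ℕ) < p.2 + k).card ≤ ∑ i ∈ Finset.range d, (i + 1 - k) := by
    rw [Finset.card_filter, ← Finset.univ_product_univ, Finset.sum_product,
      ← Fin.sum_univ_eq_sum_range (fun i => i + 1 - k)]
    refine Finset.sum_le_sum fun i _ => ?_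
    rw [← Finset.card_filter]
    calc _ = ((Finset.univ.filter fun j : Fin d => ¬ (i : ℕ) < j + k).map
          Fin.valEmbedding).card := (Finset.card_map _).symm
      _ ≤ (Finset.range (i + 1 - k)).card := by
          refine Finset.card_le_card fun x hx => ?_
          simp only [Finset.mem_map, Finset.mem_filter, Finset.mem_univ, true_and] at hx
          obtain ⟨j, hj, rfl⟩ := hx
          simp only [Fin.valEmbedding_apply, Finset.mem_range]
          omega
      _ = _ := by simp
  have hsum : 2 * ∑ i ∈ Finset.range d, (i + 1 - k) = (d - k) * (d - k + 1) := by
    obtain ⟨e, rfl⟩ : ∃ e, d = k + e := ⟨d - k, by omega⟩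
    clear htot hcompl hk
    rw [Finset.sum_range_add, Finset.sum_eq_zero (s := Finset.range k), zero_add,
      Nat.add_sub_cancel_left]
    · have : ∀ x, k + x + 1 - k = x + 1 := fun x => by omega
      simp_rw [this]
      induction e with
      | zero => simp
      | succ e ih => rw [Finset.sum_range_succ, mul_add, ih]; ring
    · intro i hi
      have := Finset.mem_range.1 hi
      omega
  simp only [Finset.card_univ, Fintype.card_prod, Fintype.card_fin] at htot
  nlinarith

/-- Summing a function of the set where `x` agrees with `y`, over all `x`. -/
theorem sum_agreement_le {m N : ℕ} (hN : 0 < N) (y : Fin m → Fin N)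
    (F : Finset (Fin m) → ℝ) (hF : ∀ A, 0 ≤ F A) :
    ∑ x : Fin m → Fin N, F (Finset.univ.filter fun i => y i = x i) ≤
      (N : ℝ) ^ m * ∑ A : Finset (Fin m), (1 / (N : ℝ)) ^ A.card * F A := by
  classical
  rw [← Finset.sum_fiberwise Finset.univ
    (fun x : Fin m → Fin N => Finset.univ.filter fun i => y i = x i), Finset.mul_sum]
  refine Finset.sum_le_sum fun A _ => ?_
  have hN' : (0 : ℝ) < N := by exact_mod_cast hN
  have hcard : ((Finset.univ : Finset (Fin m → Fin N)).filter
      fun x => (Finset.univ.filter fun i => y i = x i) = A).card ≤ N ^ (m - A.card) := by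
    calc _ ≤ (Fintype.piFinset fun i => if i ∈ A then {y i} else
          (Finset.univ : Finset (Fin N))).card := by
          refine Finset.card_le_card fun x hx => ?_
          rw [Fintype.mem_piFinset]
          intro i
          obtain rfl := (Finset.mem_filter.1 hx).2
          by_cases hi : y i = x i <;> simp [hi]
      _ = ∏ i, if i ∈ A then 1 else N := by
          rw [Fintype.card_piFinset]
          refine Finset.prod_congr rfl fun i _ => ?_
          split_ifs <;> simp
      _ = _ := by
          rw [Finset.prod_ite]
          simp [Finset.filter_not, Finset.card_sdiff_of_subset]
  have hpow : ((N ^ (m - A.card) : ℕ) : ℝ) = (N : ℝ) ^ m * (1 / (N : ℝ)) ^ A.card := by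
    have hA : A.card ≤ m := by simpa using A.card_le_univ
    rw [Nat.cast_pow, pow_sub₀ _ hN'.ne' hA, one_div, inv_pow]
  calc _ = ∑ x ∈ (Finset.univ : Finset (Fin m → Fin N)).filter
        (fun x => (Finset.univ.filter fun i => y i = x i) = A), F A :=
        Finset.sum_congr rfl fun x hx => by rw [(Finset.mem_filter.1 hx).2]
    _ ≤ ((N ^ (m - A.card) : ℕ) : ℝ) * F A := by
        rw [Finset.sum_const, nsmul_eq_mul]
        exact mul_le_mul_of_nonneg_right (by exact_mod_cast hcard) (hF A)
    _ = _ := by rw [hpow]; ring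

theorem sum_powers_card_le (m : ℕ) :
    ∑ A : Finset (Fin m), (1 / (m : ℝ)) ^ A.card ≤ Real.exp 1 := by
  have h := Fintype.sum_pow_mul_eq_add_pow (Fin m) (1 / (m : ℝ)) 1
  simp only [one_pow, mul_one, Fintype.card_fin] at h
  rw [h]
  rcases Nat.eq_zero_or_pos m with rfl | hm
  · simp
  · calc (1 / (m : ℝ) + 1) ^ m ≤ (Real.exp (1 / m)) ^ m :=
        pow_le_pow_left₀ (by positivity) (Real.add_one_le_exp _) _
      _ = Real.exp 1 := by
        rw [← Real.exp_nat_mul]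
        congr 1
        field_simp

end Counting

/-! ### Upper bound for permuted triangular submatrices -/

section UpperBound

variable {𝒜 : Type*} [Zero 𝒜] [MeasurableSpace 𝒜] [MeasurableSingletonClass 𝒜]
  {μ : Measure 𝒜} {Ω : Type*} [MeasurableSpace Ω] {P : Measure Ω} {n : ℕ}
  {X : Ω → Matrix (Fin n) (Fin n) 𝒜}

omit [MeasurableSpace 𝒜] [MeasurableSingletonClass 𝒜] in
/-- Dropping the last `k` rows and the first `k` columns of a triangular array of size `d + k`
leaves a square array whose entries vanish at the positions `(i, j)` with `i < j + k`. -/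
theorem exists_zero_pattern_of_le_maxSubmatrixSize {A : Matrix (Fin n) (Fin n) 𝒜} {d k : ℕ}
    (h : d + k ≤ maxSubmatrixSize IsPermutedTriangular A) :
    ∃ r c : Fin d ↪ Fin n, ∀ i j : Fin d, (i : ℕ) < j + k → A (r i) (c j) = 0 := by
  rcases Nat.eq_zero_or_pos d with rfl | hd
  · exact ⟨⟨Fin.elim0, fun i => i.elim0⟩, ⟨Fin.elim0, fun i => i.elim0⟩, fun i => i.elim0⟩
  obtain ⟨r, c, σ, τ, ht⟩ :=
    exists_of_maxSubmatrixSize_pos (P := IsPermutedTriangular) (A := A) (by omega)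
  refine ⟨⟨fun i => r (σ ⟨i, by omega⟩), fun i j hij => ?_⟩,
    ⟨fun j => c (τ ⟨j + k, by omega⟩), fun i j hij => ?_⟩, fun i j hij => ?_⟩
  · simpa [Fin.ext_iff] using hij
  · simpa [Fin.ext_iff] using hij
  · exact ht _ _ (Fin.lt_def.2 hij)

/-- First moment bound. Only the part of a triangular array that is obtained by dropping the last
`k` rows and the first `k` columns is counted: these rows and columns carry few zeros and
would only inflate the expected number. -/
theorem measureReal_le_maxSubmatrixSize_permuted_le [IsProbabilityMeasure P]
    (hlaw : ∀ i j, HasLaw (fun ω => X ω i j) μ P)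
    (hind : iIndepFun (fun (ij : Fin n × Fin n) ω => X ω ij.1 ij.2) P)
    {Q : ℝ} (hQ : Q = 1 / μ.real {0}) (hQ1 : 1 < Q) {d k : ℕ} (hk : k ≤ d) :
    P.real {ω | d + k ≤ maxSubmatrixSize IsPermutedTriangular (X ω)} ≤
      (n : ℝ) ^ (2 * d) * Q ^ (-((d : ℝ) ^ 2 - (d - k) * (d - k + 1) / 2)) := by
  classical
  set D := (Finset.univ : Finset (Fin d × Fin d)).filter fun p => (p.1 : ℕ) < p.2 + k with hD
  set E : (Fin d ↪ Fin n) × (Fin d ↪ Fin n) → Set Ω := fun α =>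
    agreeEvent (fun (ij : Fin n × Fin n) ω => X ω ij.1 ij.2) (fun _ => 0)
      (D.map (α.1.prodMap α.2)) with hE
  have hsub : {ω | d + k ≤ maxSubmatrixSize IsPermutedTriangular (X ω)} ⊆ ⋃ α, E α := by
    intro ω hω
    obtain ⟨r, c, h⟩ := exists_zero_pattern_of_le_maxSubmatrixSize hω
    refine Set.mem_iUnion.2 ⟨(r, c), fun e he => ?_⟩
    obtain ⟨p, hp, rfl⟩ := Finset.mem_map.1 he
    exact h p.1 p.2 (Finset.mem_filter.1 hp).2
  have hprob : ∀ α, P.real (E α) = (μ.real {0}) ^ D.card := fun α => by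
    refine (measureReal_agreeEvent (fun e : Fin n × Fin n => hlaw e.1 e.2) hind _ _).trans ?_
    rw [Finset.prod_const, Finset.card_map]
  have hp : μ.real {0} = Q⁻¹ := by rw [hQ, one_div, inv_inv]
  have hQ0 : 0 < Q := by linarith
  have hcard : ((Fintype.card ((Fin d ↪ Fin n) × (Fin d ↪ Fin n)) : ℕ) : ℝ) ≤
      (n : ℝ) ^ (2 * d) := by
    have h1 : Fintype.card (Fin d ↪ Fin n) ≤ n ^ d := by
      simpa [Fintype.card_embedding_eq] using Nat.descFactorial_le_pow n d
    have h2 : Fintype.card ((Fin d ↪ Fin n) × (Fin d ↪ Fin n)) ≤ n ^ (2 * d) := by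
      rw [Fintype.card_prod, two_mul, pow_add]
      exact Nat.mul_le_mul h1 h1
    exact_mod_cast h2
  have hzeros : (d : ℝ) ^ 2 - (d - k) * (d - k + 1) / 2 ≤ D.card := by
    have h1 := two_mul_sq_le_card d k hk
    have h2 : (2 * d ^ 2 : ℝ) ≤ 2 * D.card + ((d - k : ℕ) : ℝ) * (((d - k : ℕ) : ℝ) + 1) := by
      exact_mod_cast h1
    rw [Nat.cast_sub hk] at h2
    linarith
  calc P.real {ω | d + k ≤ maxSubmatrixSize IsPermutedTriangular (X ω)}
      ≤ P.real (⋃ α, E α) := measureReal_mono hsub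
    _ ≤ ∑ α, P.real (E α) := measureReal_iUnion_fintype_le _
    _ = (Fintype.card ((Fin d ↪ Fin n) × (Fin d ↪ Fin n)) : ℕ) * Q ^ (-(D.card : ℝ)) := by
        rw [Finset.sum_congr rfl fun α _ => hprob α, Finset.sum_const, nsmul_eq_mul, hp,
          Real.rpow_neg hQ0.le, Real.rpow_natCast, inv_pow, Finset.card_univ]
    _ ≤ _ := mul_le_mul hcard (Real.rpow_le_rpow_of_exponent_le hQ1.le (by linarith))
        (by positivity) (by positivity)

end UpperBound

/-! ### Lower bound for special triangular submatrices -/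

section LowerBound

/-- The `x`-th index of the `i`-th of `m` consecutive blocks of length `N`. -/
def blockIndex {m N n : ℕ} (h : m * N ≤ n) (i : Fin m) (x : Fin N) : Fin n :=
  Fin.castLE h (finProdFinEquiv (i, x))

theorem blockIndex_val {m N n : ℕ} (h : m * N ≤ n) (i : Fin m) (x : Fin N) :
    (blockIndex h i x : ℕ) = x + N * i := rfl

theorem blockIndex_inj {m N n : ℕ} (h : m * N ≤ n) {i j : Fin m} {x y : Fin N} :
    blockIndex h i x = blockIndex h j y ↔ i = j ∧ x = y := by
  simp [blockIndex, Fin.castLE_inj]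

theorem blockIndex_lt {m N n : ℕ} (h : m * N ≤ n) {i j : Fin m} (hij : i < j) (x y : Fin N) :
    blockIndex h i x < blockIndex h j y := by
  rw [Fin.lt_def, blockIndex_val, blockIndex_val]
  have h1 := x.2
  have h2 : N * (i + 1) ≤ N * j := Nat.mul_le_mul_left _ (Fin.lt_def.1 hij)
  rw [mul_add, mul_one] at h2
  omega

theorem blockIndex_div {m N n : ℕ} (h : m * N ≤ n) (i : Fin m) (x : Fin N) :
    (blockIndex h i x : ℕ) / N = i := by
  have h1 := x.2
  rw [blockIndex_val, Nat.add_mul_div_left _ _ (by omega), Nat.div_eq_of_lt h1, zero_add]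

/-- One index from each block. -/
def blockSelection {m N n : ℕ} (h : m * N ≤ n) (x : Fin m → Fin N) : Fin m ↪o Fin n :=
  OrderEmbedding.ofStrictMono (fun i => blockIndex h i (x i))
    fun i j hij => blockIndex_lt h hij (x i) (x j)

/-- The inverse probability of the prescribed entries in a block `A × B` of a special triangular
array, if `0` has probability `1 / Q` and `1` has probability `1 / K`. -/
theorem prod_inv_le {m : ℕ} {Q K : ℝ} (hQ : 1 ≤ Q) (hK : 1 ≤ K) (A B : Finset (Fin m)) :
    ∏ p ∈ (A ×ˢ B).filter (fun p => p.1 ≤ p.2), (if p.1 = p.2 then K else Q) ≤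
      K ^ (A.card + B.card) *
        Q ^ (∑ k ∈ Finset.range A.card, min B.card (m - 1 - k)) := by
  classical
  rw [Finset.prod_ite, Finset.prod_const, Finset.prod_const]
  refine mul_le_mul (pow_le_pow_right₀ hK ?_) (pow_le_pow_right₀ hQ ?_) (by positivity)
    (by positivity)
  · calc _ ≤ (A.map ⟨fun i => (i, i), fun i j h => (Prod.ext_iff.1 h).1⟩).card := by
          refine Finset.card_le_card fun p hp => ?_
          simp only [Finset.mem_filter, Finset.mem_product] at hp
          exact Finset.mem_map.2 ⟨p.1, hp.1.1.1, Prod.ext rfl hp.2⟩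
      _ ≤ _ := by rw [Finset.card_map]; omega
  · refine le_trans (Finset.card_le_card fun p hp => ?_) (card_lt_product_le A B)
    simp only [Finset.mem_filter] at hp ⊢
    exact ⟨hp.1.1, lt_of_le_of_ne hp.1.2 hp.2⟩

/-- The sum over all pairs of nonempty agreement sets that bounds the relative variance. -/
theorem sum_agreement_sets_le {m N : ℕ} (hm : 0 < m) (hN : 0 < N) {Q K ℓ η : ℝ} (hQ : 1 < Q)
    (hK : 1 ≤ K) (hη : 0 ≤ η) (hℓ : K * m / N ≤ Q ^ (-ℓ))
    (hexp : ∀ a b : ℕ, 1 ≤ a → a ≤ m → 1 ≤ b → b ≤ m →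
      Q ^ (((∑ k ∈ Finset.range a, min b (m - 1 - k) : ℕ) : ℝ) - (a + b) * ℓ) ≤ η) :
    ∑ A : Finset (Fin m), (1 / (N : ℝ)) ^ A.card * ∑ B : Finset (Fin m),
      (1 / (N : ℝ)) ^ B.card * (if A.Nonempty ∧ B.Nonempty then
        ∏ p ∈ (A ×ˢ B).filter (fun p => p.1 ≤ p.2), (if p.1 = p.2 then K else Q) else 0) ≤
      Real.exp 1 * Real.exp 1 * η := by
  have hm' : (0 : ℝ) < m := by exact_mod_cast hm
  have hN' : (0 : ℝ) < N := by exact_mod_cast hN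
  have hQ0 : 0 < Q := by linarith
  have key : ∀ A B : Finset (Fin m), (1 / (N : ℝ)) ^ A.card * ((1 / (N : ℝ)) ^ B.card *
      (if A.Nonempty ∧ B.Nonempty then
        ∏ p ∈ (A ×ˢ B).filter (fun p => p.1 ≤ p.2), (if p.1 = p.2 then K else Q) else 0)) ≤
      (1 / (m : ℝ)) ^ A.card * ((1 / (m : ℝ)) ^ B.card * η) := by
    intro A B
    split_ifs with hAB
    · set z := ∑ k ∈ Finset.range A.card, min B.card (m - 1 - k) with hz
      have h1 : (K * m / N) ^ (A.card + B.card) * Q ^ z ≤ η := by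
        calc (K * m / N) ^ (A.card + B.card) * Q ^ z
            ≤ (Q ^ (-ℓ)) ^ (A.card + B.card) * Q ^ z := by gcongr
          _ = Q ^ ((z : ℝ) - (A.card + B.card) * ℓ) := by
            rw [← Real.rpow_natCast, ← Real.rpow_natCast, ← Real.rpow_mul hQ0.le,
              ← Real.rpow_add hQ0]
            congr 1
            push_cast
            ring
          _ ≤ η := hexp _ _ hAB.1.card_pos (by simpa using A.card_le_univ) hAB.2.card_pos
            (by simpa using B.card_le_univ)
      calc _ ≤ (1 / (N : ℝ)) ^ A.card * ((1 / (N : ℝ)) ^ B.card *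
            (K ^ (A.card + B.card) * Q ^ z)) := by
            gcongr
            exact prod_inv_le hQ.le hK A B
        _ = (1 / (m : ℝ)) ^ A.card * ((1 / (m : ℝ)) ^ B.card *
            ((K * m / N) ^ (A.card + B.card) * Q ^ z)) := by
            rw [div_pow (K * m), mul_pow]
            simp only [pow_add, one_div, inv_pow]
            field_simp
        _ ≤ _ := by gcongr
    · rw [mul_zero, mul_zero]
      positivity
  calc _ ≤ ∑ A : Finset (Fin m), ∑ B : Finset (Fin m),
        (1 / (m : ℝ)) ^ A.card * ((1 / (m : ℝ)) ^ B.card * η) := by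
        refine Finset.sum_le_sum fun A _ => ?_
        rw [Finset.mul_sum]
        exact Finset.sum_le_sum fun B _ => key A B
    _ = (∑ A : Finset (Fin m), (1 / (m : ℝ)) ^ A.card) *
        (∑ B : Finset (Fin m), (1 / (m : ℝ)) ^ B.card) * η := by
        rw [Finset.sum_mul_sum, Finset.sum_mul]
        refine Finset.sum_congr rfl fun A _ => ?_
        rw [Finset.sum_mul]
        exact Finset.sum_congr rfl fun B _ => by ring
    _ ≤ _ := by
        have := sum_powers_card_le m
        gcongr

variable {𝒜 : Type*} [Zero 𝒜] [One 𝒜] [MeasurableSpace 𝒜] [MeasurableSingletonClass 𝒜]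
  {μ : Measure 𝒜} {Ω : Type*} [MeasurableSpace Ω] {P : Measure Ω} {n : ℕ}
  {X : Ω → Matrix (Fin n) (Fin n) 𝒜}

/-- Second moment bound. Rows and columns are chosen one from each of `m` blocks, so that two
choices share an entry only at the same position of the array, and the choices are
automatically in order. -/
theorem measureReal_maxSubmatrixSize_special_lt_le [IsProbabilityMeasure P]
    (hlaw : ∀ i j, HasLaw (fun ω => X ω i j) μ P)
    (hind : iIndepFun (fun (ij : Fin n × Fin n) ω => X ω ij.1 ij.2) P)
    {Q K : ℝ} (hQ : Q = 1 / μ.real {0}) (hK : K = 1 / μ.real {1}) (hQ1 : 1 < Q) (hK1 : 1 ≤ K)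
    {m N : ℕ} (hmN : m * N ≤ n) (hm : 0 < m) (hN : 0 < N) {ℓ η : ℝ} (hη : 0 ≤ η)
    (hℓ : K * m / N ≤ Q ^ (-ℓ))
    (hexp : ∀ a b : ℕ, 1 ≤ a → a ≤ m → 1 ≤ b → b ≤ m →
      Q ^ (((∑ k ∈ Finset.range a, min b (m - 1 - k) : ℕ) : ℝ) - (a + b) * ℓ) ≤ η) :
    P.real {ω | maxSubmatrixSize IsSpecialTriangular (X ω) < m} ≤
      Real.exp 1 * Real.exp 1 * η := by
  classical
  have hQ0 : 0 < Q := by linarith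
  have hK0 : 0 < K := by linarith
  set ι := (Fin m → Fin N) × (Fin m → Fin N)
  set D := (Finset.univ : Finset (Fin m × Fin m)).filter fun p => p.1 ≤ p.2 with hD
  -- On the union of the diagonal blocks the prescribed entry is `1`, elsewhere `0`.
  set t : Fin n × Fin n → 𝒜 := fun e => if (e.1 : ℕ) / N = e.2 / N then 1 else 0 with ht
  set F : ι → (Fin m × Fin m ↪ Fin n × Fin n) := fun α =>
    (blockSelection hmN α.1).toEmbedding.prodMap (blockSelection hmN α.2).toEmbedding with hF
  have hFa : ∀ α p, F α p = (blockIndex hmN p.1 (α.1 p.1), blockIndex hmN p.2 (α.2 p.2)) :=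
    fun α p => rfl
  have htF : ∀ α p, t (F α p) = if p.1 = p.2 then 1 else 0 := by
    intro α p
    simp only [ht, hFa, blockIndex_div, Fin.val_inj]
  set Y : Fin n × Fin n → Ω → 𝒜 := fun ij ω => X ω ij.1 ij.2 with hY
  have hlawY : ∀ e, HasLaw (Y e) μ P := fun e => hlaw e.1 e.2
  set E : ι → Set Ω := fun α => agreeEvent Y t (D.map (F α)) with hE
  set q : Fin n × Fin n → ℝ := fun e => μ.real {t e} with hq
  have hqF : ∀ α p, q (F α p) = (if p.1 = p.2 then K else Q)⁻¹ := by
    intro α p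
    simp only [hq, htF]
    split_ifs
    · rw [hK, one_div, inv_inv]
    · rw [hQ, one_div, inv_inv]
  set w : ℝ := ∏ p ∈ D, (if p.1 = p.2 then K else Q)⁻¹ with hw
  have hw0 : 0 < w := Finset.prod_pos fun p _ => by split_ifs <;> positivity
  have hwF : ∀ α, ∏ e ∈ D.map (F α), q e = w := fun α => by
    rw [Finset.prod_map]
    exact Finset.prod_congr rfl fun p _ => hqF α p
  have hEw : ∀ α, P.real (E α) = w := fun α => by
    rw [hE, measureReal_agreeEvent hlawY hind, ← hwF α]
  set G : Finset (Fin m) → Finset (Fin m) → ℝ := fun A B =>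
    if A.Nonempty ∧ B.Nonempty then
      ∏ p ∈ (A ×ˢ B).filter (fun p => p.1 ≤ p.2), (if p.1 = p.2 then K else Q) else 0 with hG
  have hG0 : ∀ A B, 0 ≤ G A B := by
    intro A B
    simp only [hG]
    split_ifs
    · exact Finset.prod_nonneg fun p _ => by split_ifs <;> positivity
    · exact le_rfl
  -- The covariance is governed by the entries that two choices share.
  have hcov : ∀ α β : ι, P.real (E α ∩ E β) - w ^ 2 ≤
      w ^ 2 * G (Finset.univ.filter fun i => α.1 i = β.1 i)
        (Finset.univ.filter fun i => α.2 i = β.2 i) := by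
    intro α β
    set A := Finset.univ.filter fun i => α.1 i = β.1 i with hA
    set B := Finset.univ.filter fun i => α.2 i = β.2 i with hB
    have hinter : D.map (F α) ∩ D.map (F β) =
        ((A ×ˢ B).filter fun p => p.1 ≤ p.2).map (F α) := by
      ext e
      simp only [Finset.mem_inter, Finset.mem_map, Finset.mem_filter, Finset.mem_product, hD, hA,
        hB, Finset.mem_univ, true_and]
      constructor
      · rintro ⟨⟨p, hp, rfl⟩, p', hp', hpp⟩
        rw [hFa, hFa, Prod.mk.injEq, blockIndex_inj, blockIndex_inj] at hpp
        obtain ⟨⟨h1, h2⟩, h3, h4⟩ := hpp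
        rw [h1] at h2
        rw [h3] at h4
        exact ⟨p, ⟨⟨h2.symm, h4.symm⟩, hp⟩, rfl⟩
      · rintro ⟨p, ⟨⟨h1, h2⟩, hp⟩, rfl⟩
        exact ⟨⟨p, hp, rfl⟩, p, hp, by rw [hFa, hFa, h1, h2]⟩
    have hprod : P.real (E α ∩ E β) *
        ∏ p ∈ (A ×ˢ B).filter (fun p => p.1 ≤ p.2), (if p.1 = p.2 then K else Q)⁻¹ = w ^ 2 := by
      have h1 := Finset.prod_union_inter (s₁ := D.map (F α)) (s₂ := D.map (F β)) (f := q)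
      rw [hwF, hwF, hinter, Finset.prod_map, Finset.prod_congr rfl fun p _ => hqF α p] at h1
      rw [hE, agreeEvent_inter, measureReal_agreeEvent hlawY hind, sq, ← h1]
    rw [Finset.prod_inv_distrib] at hprod
    have hpos : 0 < ∏ p ∈ (A ×ˢ B).filter (fun p => p.1 ≤ p.2), (if p.1 = p.2 then K else Q) :=
      Finset.prod_pos fun p _ => by split_ifs <;> positivity
    rw [mul_inv_eq_iff_eq_mul₀ hpos.ne'] at hprod
    rw [hprod]
    simp only [hG]
    split_ifs with hAB
    · linarith [sq_nonneg w]
    · have hempty : A ×ˢ B = ∅ := by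
        rw [Finset.product_eq_empty]
        by_contra hcon
        push Not at hcon
        exact hAB hcon
      simp [hempty]
  have hsum : ∀ α : ι, ∑ β : ι, (P.real (E α ∩ E β) - w ^ 2) ≤
      w ^ 2 * ((N : ℝ) ^ m * ((N : ℝ) ^ m * (Real.exp 1 * Real.exp 1 * η))) := by
    intro α
    calc ∑ β : ι, (P.real (E α ∩ E β) - w ^ 2)
        ≤ ∑ β : ι, w ^ 2 * G (Finset.univ.filter fun i => α.1 i = β.1 i)
          (Finset.univ.filter fun i => α.2 i = β.2 i) :=
          Finset.sum_le_sum fun β _ => hcov α β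
      _ = w ^ 2 * ∑ x : Fin m → Fin N, ∑ y : Fin m → Fin N,
          G (Finset.univ.filter fun i => α.1 i = x i)
            (Finset.univ.filter fun i => α.2 i = y i) := by
          rw [← Finset.mul_sum, Fintype.sum_prod_type]
      _ ≤ w ^ 2 * ∑ x : Fin m → Fin N, (N : ℝ) ^ m * ∑ B : Finset (Fin m),
          (1 / (N : ℝ)) ^ B.card * G (Finset.univ.filter fun i => α.1 i = x i) B := by
          gcongr with x
          exact sum_agreement_le hN α.2 _ fun B => hG0 _ _
      _ ≤ w ^ 2 * ((N : ℝ) ^ m * ((N : ℝ) ^ m * ∑ A : Finset (Fin m), (1 / (N : ℝ)) ^ A.card *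
          ∑ B : Finset (Fin m), (1 / (N : ℝ)) ^ B.card * G A B)) := by
          rw [← Finset.mul_sum]
          gcongr
          exact sum_agreement_le hN α.1 (fun A => ∑ B : Finset (Fin m),
            (1 / (N : ℝ)) ^ B.card * G A B) fun A => Finset.sum_nonneg fun B _ =>
              mul_nonneg (by positivity) (hG0 A B)
      _ ≤ _ := by
          gcongr
          exact sum_agreement_sets_le hm hN hQ1 hK1 hη hℓ hexp
  have hsm := sq_mul_measureReal_forall_notMem_le E
    (fun α => nullMeasurableSet_agreeEvent hlawY t _) w hEw
  have hN' : (0 : ℝ) < N := by exact_mod_cast hN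
  have hcard : (Fintype.card ι : ℝ) = (N : ℝ) ^ m * (N : ℝ) ^ m := by simp [ι]
  have hsm2 : (Fintype.card ι * w) ^ 2 * P.real {ω | ∀ α, ω ∉ E α} ≤
      (Fintype.card ι * w) ^ 2 * (Real.exp 1 * Real.exp 1 * η) := by
    refine hsm.trans ((Finset.sum_le_sum fun α _ => hsum α).trans (le_of_eq ?_))
    rw [Finset.sum_const, nsmul_eq_mul, Finset.card_univ, hcard]
    ring
  have hpos : 0 < (Fintype.card ι * w) ^ 2 := by
    rw [hcard]
    positivity
  refine le_trans (measureReal_mono ?_) (le_of_mul_le_mul_left hsm2 hpos)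
  intro ω hω α hα
  refine absurd (le_maxSubmatrixSize (P := IsSpecialTriangular) (A := X ω)
    (blockSelection hmN α.1) (blockSelection hmN α.2) ⟨fun i j hij => ?_, fun i => ?_⟩)
    (not_le.2 hω)
  · have := hα (F α (i, j)) (Finset.mem_map_of_mem _ (by simp [hD, hij.le]))
    rw [htF, if_neg hij.ne] at this
    exact this
  · have := hα (F α (i, i)) (Finset.mem_map_of_mem _ (by simp [hD]))
    rw [htF, if_pos rfl] at this
    exact this

end LowerBound

/-! ### Tails on the logarithmic scale -/

section Asymptotics

theorem tendstoInProbability_of_tails {Ω : ℕ → Type*} [∀ n, MeasurableSpace (Ω n)]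
    {Pr : ∀ n, Measure (Ω n)} [∀ n, IsProbabilityMeasure (Pr n)] {lo T up : ∀ n, Ω n → ℕ}
    {s : ℕ → ℝ} {c : ℝ} (hs : Tendsto s atTop atTop)
    (hlo : ∀ n ω, lo n ω ≤ T n ω) (hup : ∀ n ω, T n ω ≤ up n ω)
    (hlower : ∀ ε : ℝ, 0 < ε →
      Tendsto (fun n => (Pr n).real {ω | (lo n ω : ℝ) ≤ (c - ε) * s n}) atTop (𝓝 0))
    (hupper : ∀ ε : ℝ, 0 < ε →
      Tendsto (fun n => (Pr n).real {ω | (c + ε) * s n ≤ (up n ω : ℝ)}) atTop (𝓝 0)) :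
    TendstoInProbability Pr (fun n ω => T n ω / s n) c := by
  intro ε hε
  have hreal : Tendsto (fun n => (Pr n).real {ω | ε ≤ |T n ω / s n - c|}) atTop (𝓝 0) := by
    have hadd := (hlower ε hε).add (hupper ε hε)
    rw [add_zero] at hadd
    refine squeeze_zero' (Eventually.of_forall fun n => measureReal_nonneg) ?_ hadd
    filter_upwards [hs.eventually_gt_atTop 0] with n hn
    refine le_trans (measureReal_mono ?_) (measureReal_union_le _ _)
    intro ω hω
    have h1 : (lo n ω : ℝ) ≤ T n ω := by exact_mod_cast hlo n ω
    have h2 : (T n ω : ℝ) ≤ up n ω := by exact_mod_cast hup n ω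
    rcases le_abs.1 (show ε ≤ |T n ω / s n - c| from hω) with h | h
    · right
      have : c + ε ≤ T n ω / s n := by linarith
      rw [le_div_iff₀ hn] at this
      exact this.trans h2
    · left
      have : T n ω / s n ≤ c - ε := by linarith
      rw [div_le_iff₀ hn] at this
      exact h1.trans this
  have := ENNReal.tendsto_ofReal hreal
  simpa using this

theorem tendsto_rpow_quadratic {Q : ℝ} (hQ : 1 < Q) {φ : ℝ} (hφ : 0 < φ) (β γ : ℝ) :
    Tendsto (fun x : ℝ => Q ^ (-φ * x ^ 2 + β * x + γ)) atTop (𝓝 0) := by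
  refine (tendsto_rpow_atBot_of_base_gt_one Q hQ).comp ?_
  have h1 : Tendsto (fun x : ℝ => -φ * x + β) atTop atBot :=
    tendsto_atBot_add_const_right _ _ (tendsto_id.const_mul_atTop_of_neg (by linarith))
  have h2 : Tendsto (fun x : ℝ => x * (-φ * x + β) + γ) atTop atBot :=
    tendsto_atBot_add_const_right _ _ (tendsto_id.atTop_mul_atBot₀ h1)
  refine h2.congr fun x => ?_
  ring

theorem tendsto_logb_natCast {Q : ℝ} (hQ : 1 < Q) :
    Tendsto (fun n : ℕ => Real.logb Q n) atTop atTop :=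
  (Real.tendsto_logb_atTop hQ).comp tendsto_natCast_atTop_atTop

/-- The exponent of the first moment, in the case of `m` rows and columns of which `k`
are dropped: the choice of `k` next to `L` makes it smallest. -/
theorem upper_exponent_le {y L m k : ℝ} (hy : 2 ≤ y) (hL : 0 ≤ L) (hk : k ≤ L)
    (hk' : L ≤ k + 1) (hk0 : 0 ≤ k) (hm : y * L ≤ m) (hm' : m ≤ y * L + 1) :
    L * (2 * (m - k)) + -((m - k) ^ 2 - (m - k - k) * (m - k - k + 1) / 2) ≤
      -(y ^ 2 / 2 - 2 * y + 1) * L ^ 2 + y / 2 * L + 3 / 2 := by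
  have h1 : (L - k) ^ 2 ≤ 1 := by nlinarith
  have h2 : 0 ≤ (m - y * L) * ((m + y * L) / 2 - 2 * L) :=
    mul_nonneg (by linarith) (by nlinarith)
  nlinarith

/-- The exponent of a pair of agreement sets of sizes `a` and `b` in the second moment. -/
theorem lower_exponent_le {x ℓ δ : ℝ} {m a b : ℕ} (hx : 5 / 2 ≤ x) (hx' : x ≤ 7 / 2)
    (hℓ : 1 ≤ ℓ) (hm : (m : ℝ) ≤ x * ℓ) (hm' : x * ℓ ≤ m + 1) (hδ0 : 0 ≤ δ) (hδ : δ ≤ 1 / 4)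
    (hδ' : δ ≤ -(x ^ 2 / 2 - 2 * x + 1)) (ha : 1 ≤ a) (ham : a ≤ m) (hb : 1 ≤ b) (hbm : b ≤ m) :
    ((∑ k ∈ Finset.range a, min b (m - 1 - k) : ℕ) : ℝ) - (a + b) * ℓ ≤ -δ * ℓ := by
  have ha1 : (1 : ℝ) ≤ a := by exact_mod_cast ha
  have hb1 : (1 : ℝ) ≤ b := by exact_mod_cast hb
  rcases le_total (a + b) m with hab | hab
  · have h1 : ((∑ k ∈ Finset.range a, min b (m - 1 - k) : ℕ) : ℝ) ≤ a * b := by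
      exact_mod_cast sum_min_le_mul m a b
    have h2 : (a + b : ℝ) ≤ m := by exact_mod_cast hab
    have h3 : (a * b : ℝ) ≤ (a + b) * (7 / 2 * ℓ) / 4 := by
      nlinarith [sq_nonneg (a - b : ℝ)]
    nlinarith
  · have h1 := two_mul_sum_min_le ham hbm hab
    have h2 : 0 ≤ (x * ℓ - m) * ((x * ℓ + m) / 2 - 2 * ℓ) :=
      mul_nonneg (by linarith) (by nlinarith)
    have h3 : δ * ℓ ≤ -(x ^ 2 / 2 - 2 * x + 1) * ℓ ^ 2 := by
      have : δ * ℓ ≤ δ * ℓ ^ 2 := mul_le_mul_of_nonneg_left (by nlinarith) hδ0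
      nlinarith [sq_nonneg ℓ]
    nlinarith [sq_nonneg (m - a - ℓ : ℝ), sq_nonneg (m - b - ℓ : ℝ)]

/-- The base scale `1 / N` of the second moment, with the factors `K` and `m` that come from the
diagonal and from the choice of the agreement sets, is `n ^ (-(1 - τ))` up to a loss that `n ^ τ`
absorbs. -/
theorem mul_div_le_rpow_neg {Q K L τ n m N : ℝ} (hQ : 0 < Q) (hK : 0 ≤ K) (hn : n = Q ^ L)
    (hm : m ≤ 4 * L) (hm0 : 0 < m) (hN : 0 < N) (hnN : n ≤ 2 * (m * N))
    (hτ : 32 * K * L ^ 2 ≤ Q ^ (τ * L)) : K * m / N ≤ Q ^ (-((1 - τ) * L)) := by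
  have hn0 : 0 < n := hn ▸ Real.rpow_pos_of_pos hQ L
  have h1 : Q ^ (-((1 - τ) * L)) = Q ^ (τ * L) / n := by
    rw [hn, ← Real.rpow_sub hQ]
    congr 1
    ring
  rw [h1, div_le_div_iff₀ hN hn0]
  calc K * m * n ≤ K * m * (2 * (m * N)) := by gcongr
    _ = 2 * K * m ^ 2 * N := by ring
    _ ≤ 2 * K * (4 * L) ^ 2 * N := by gcongr
    _ = 32 * K * L ^ 2 * N := by ring
    _ ≤ Q ^ (τ * L) * N := by gcongr

variable {𝒜 : Type*} [Zero 𝒜] [MeasurableSpace 𝒜] [MeasurableSingletonClass 𝒜]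
  {μ : Measure 𝒜} {Ω : ℕ → Type*} [∀ n, MeasurableSpace (Ω n)]
  {Pr : ∀ n, Measure (Ω n)} [∀ n, IsProbabilityMeasure (Pr n)]
  {X : ∀ n, Ω n → Matrix (Fin n) (Fin n) 𝒜}

theorem tendsto_measureReal_permuted_upper_tail
    (hlaw : ∀ n i j, HasLaw (fun ω => X n ω i j) μ (Pr n))
    (hind : ∀ n, iIndepFun (fun (ij : Fin n × Fin n) ω => X n ω ij.1 ij.2) (Pr n))
    {Q : ℝ} (hQ : Q = 1 / μ.real {0}) (hQ1 : 1 < Q) (ε : ℝ) (hε : 0 < ε) :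
    Tendsto (fun n => (Pr n).real {ω | (2 + √2 + ε) * Real.logb Q n ≤
      (maxSubmatrixSize IsPermutedTriangular (X n ω) : ℝ)}) atTop (𝓝 0) := by
  set y := 2 + √2 + ε with hy
  have hsq : √2 ^ 2 = 2 := Real.sq_sqrt (by norm_num)
  have hs0 : 0 < √2 := by positivity
  have hy2 : 2 ≤ y := by linarith
  have hφ : 0 < y ^ 2 / 2 - 2 * y + 1 := by
    rw [hy]
    nlinarith [mul_pos hs0 hε]
  have hL := tendsto_logb_natCast hQ1
  refine squeeze_zero' (Eventually.of_forall fun n => measureReal_nonneg) ?_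
    ((tendsto_rpow_quadratic hQ1 hφ (y / 2) (3 / 2)).comp hL)
  filter_upwards [hL.eventually_ge_atTop 0, eventually_gt_atTop 0] with n hLn hn
  have hn' : (0 : ℝ) < n := by exact_mod_cast hn
  have hQ0 : 0 < Q := by linarith
  set L := Real.logb Q n with hLdef
  set m := ⌈y * L⌉₊ with hm
  set k := ⌊L⌋₊ with hk
  have hm1 : y * L ≤ m := Nat.le_ceil _
  have hm2 : (m : ℝ) ≤ y * L + 1 := (Nat.ceil_lt_add_one (by positivity)).le
  have hk1 : (k : ℝ) ≤ L := Nat.floor_le hLn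
  have hk2 : L ≤ k + 1 := (Nat.lt_floor_add_one L).le
  have hkm : 2 * k ≤ m := by
    have : (2 * k : ℝ) ≤ m := by nlinarith
    exact_mod_cast this
  have hkd : k ≤ m - k := by omega
  have hbound := measureReal_le_maxSubmatrixSize_permuted_le (hlaw n) (hind n) hQ hQ1 hkd
  rw [Nat.sub_add_cancel (by omega)] at hbound
  have hmono : (Pr n).real {ω | y * L ≤ (maxSubmatrixSize IsPermutedTriangular (X n ω) : ℝ)} ≤
      (Pr n).real {ω | m ≤ maxSubmatrixSize IsPermutedTriangular (X n ω)} :=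
    measureReal_mono fun ω hω => Nat.ceil_le.2 hω
  refine hmono.trans (hbound.trans ?_)
  have hpow : (n : ℝ) ^ (2 * (m - k)) = Q ^ (L * (2 * ((m : ℝ) - k))) := by
    rw [Real.rpow_mul hQ0.le, hLdef, Real.rpow_logb hQ0 hQ1.ne' hn', ← Real.rpow_natCast]
    push_cast [Nat.cast_sub (show k ≤ m by omega)]
    rfl
  rw [hpow, ← Real.rpow_add hQ0, Nat.cast_sub (show k ≤ m by omega)]
  exact Real.rpow_le_rpow_of_exponent_le hQ1.le
    (upper_exponent_le hy2 hLn hk1 hk2 (Nat.cast_nonneg k) hm1 hm2)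

theorem tendsto_measureReal_special_lower_tail [One 𝒜] [IsProbabilityMeasure μ]
    (hlaw : ∀ n i j, HasLaw (fun ω => X n ω i j) μ (Pr n))
    (hind : ∀ n, iIndepFun (fun (ij : Fin n × Fin n) ω => X n ω ij.1 ij.2) (Pr n))
    {Q : ℝ} (hQ : Q = 1 / μ.real {0}) (hQ1 : 1 < Q) (hp1 : 0 < μ.real {(1 : 𝒜)})
    (ε : ℝ) (hε : 0 < ε) :
    Tendsto (fun n => (Pr n).real {ω | (maxSubmatrixSize IsSpecialTriangular (X n ω) : ℝ) ≤
      (2 + √2 - ε) * Real.logb Q n}) atTop (𝓝 0) := by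
  have hL := tendsto_logb_natCast hQ1
  have hQ0 : 0 < Q := by linarith
  wlog hε' : ε ≤ 1 / 4 generalizing ε
  · refine squeeze_zero' (Eventually.of_forall fun n => measureReal_nonneg) ?_
      (this (1 / 4) (by norm_num) le_rfl)
    filter_upwards [hL.eventually_ge_atTop 0] with n hn
    refine measureReal_mono fun ω hω => ?_
    simp only [Set.mem_ofPred_eq] at hω ⊢
    nlinarith
  set K : ℝ := 1 / μ.real {(1 : 𝒜)} with hK
  have hK1 : 1 ≤ K := one_le_one_div hp1 measureReal_le_one
  have hsq : √2 ^ 2 = 2 := Real.sq_sqrt (by norm_num)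
  have hs0 : 7 / 5 ≤ √2 := Real.le_sqrt_of_sq_le (by norm_num)
  have hs1 : √2 ≤ 3 / 2 := Real.sqrt_le_iff.2 ⟨by norm_num, by norm_num⟩
  -- The size `x ℓ` with `ℓ = (1 - τ) L` lies above `(2 + √2 - ε) L`, while the factor `n ^ τ`
  -- that is given away absorbs the powers of `log n`.
  set x := 2 + √2 - ε / 2 with hx
  set τ := ε / 20 with hτ
  set δ := min (1 / 4) (-(x ^ 2 / 2 - 2 * x + 1)) with hδ
  have hφ : 0 < -(x ^ 2 / 2 - 2 * x + 1) := by
    rw [hx]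
    nlinarith
  have hδ0 : 0 < δ := lt_min (by norm_num) hφ
  have hlim : Tendsto (fun n : ℕ => Real.exp 1 * Real.exp 1 *
      Q ^ (-δ * ((1 - τ) * Real.logb Q n))) atTop (𝓝 0) := by
    rw [← mul_zero (Real.exp 1 * Real.exp 1)]
    refine Tendsto.const_mul _ ((tendsto_rpow_atBot_of_base_gt_one Q hQ1).comp ?_)
    exact (hL.const_mul_atTop (by linarith : 0 < 1 - τ)).const_mul_atTop_of_neg (by linarith)
  have hlittle : ∀ᶠ n : ℕ in atTop, 32 * K * Real.logb Q n ^ 2 ≤ Q ^ (τ * Real.logb Q n) := by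
    have hb : 0 < Real.log Q * τ := mul_pos (Real.log_pos hQ1) (by positivity)
    have h1 := (isLittleO_pow_exp_pos_mul_atTop 2 hb).bound
      (show (0 : ℝ) < 1 / (32 * K) by positivity)
    filter_upwards [hL.eventually h1] with n hn
    rw [Real.norm_of_nonneg (by positivity), Real.norm_of_nonneg (by positivity),
      one_div_mul_eq_div, le_div_iff₀ (by positivity)] at hn
    rw [Real.rpow_def_of_pos hQ0, ← mul_assoc]
    linarith
  refine squeeze_zero' (Eventually.of_forall fun n => measureReal_nonneg) ?_ hlim
  filter_upwards [hL.eventually_ge_atTop 2, hL.eventually_ge_atTop (1 / (ε / 4)), hlittle,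
    eventually_gt_atTop 0] with n hL2 hLε hlit hn
  have hn' : (0 : ℝ) < n := by exact_mod_cast hn
  set L := Real.logb Q n with hLdef
  have hnL : (n : ℝ) = Q ^ L := (Real.rpow_logb hQ0 hQ1.ne' hn').symm
  set ℓ := (1 - τ) * L with hℓdef
  have hτ0 : 0 < τ := by positivity
  have hτL0 : τ * L ≤ L / 2 := by
    have : τ * L ≤ 1 / 2 * L := mul_le_mul_of_nonneg_right (by linarith) (by linarith)
    linarith
  have hℓτ : ℓ = L - τ * L := by
    rw [hℓdef]
    ring
  have hℓ1 : 1 ≤ ℓ := by linarith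
  have hℓL : ℓ ≤ L := by linarith [mul_nonneg hτ0.le (by linarith : 0 ≤ L)]
  have hxℓ1 : 1 ≤ x * ℓ := one_le_mul_of_one_le_of_one_le (by linarith) hℓ1
  have hxℓ2 : x * ℓ ≤ 4 * L := mul_le_mul (by linarith) hℓL (by linarith) (by norm_num)
  rw [div_le_iff₀ (by positivity)] at hLε
  set m := ⌊x * ℓ⌋₊ with hm
  have hm1 : (m : ℝ) ≤ x * ℓ := Nat.floor_le (by linarith)
  have hm2 : x * ℓ < m + 1 := Nat.lt_floor_add_one _
  have hm0 : 0 < m := Nat.floor_pos.2 hxℓ1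
  have hm0' : (0 : ℝ) < m := by exact_mod_cast hm0
  have hm4 : (m : ℝ) ≤ 4 * L := hm1.trans hxℓ2
  have hτL : Q ^ (τ * L) ≤ n := by
    rw [hnL]
    exact Real.rpow_le_rpow_of_exponent_le hQ1.le (by linarith)
  have hmn : m ≤ n := by
    have h1 : 4 * L ≤ 32 * K * L ^ 2 := by
      have : L * 1 ≤ L * (K * L) :=
        mul_le_mul_of_nonneg_left (one_le_mul_of_one_le_of_one_le hK1 (by linarith)) (by linarith)
      linarith
    have h2 : (m : ℝ) ≤ n := by linarith
    exact_mod_cast h2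
  set N := n / m with hN
  have hN0 : 0 < N := Nat.div_pos hmn hm0
  have hmN : m * N ≤ n := Nat.mul_div_le n m
  have hN0' : (0 : ℝ) < N := by exact_mod_cast hN0
  have hnN : (n : ℝ) ≤ 2 * (m * N) := by
    have h1 : n < m * (N + 1) := Nat.lt_mul_div_succ n hm0
    have h2 : m ≤ m * N := Nat.le_mul_of_pos_right m hN0
    have h3 : n ≤ 2 * (m * N) := by linarith
    exact_mod_cast h3
  have hscale : K * m / N ≤ Q ^ (-ℓ) :=
    mul_div_le_rpow_neg hQ0 (by linarith) hnL hm4 hm0' hN0' hnN hlit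
  have hbound := measureReal_maxSubmatrixSize_special_lt_le (hlaw n) (hind n) hQ hK hQ1 hK1
    hmN hm0 hN0 (η := Q ^ (-δ * ℓ)) (by positivity) hscale
    (fun a b ha ham hb hbm => Real.rpow_le_rpow_of_exponent_le hQ1.le
      (lower_exponent_le (by linarith) (by linarith) hℓ1 hm1 hm2.le hδ0.le (min_le_left _ _)
        (min_le_right _ _) ha ham hb hbm))
  refine le_trans (measureReal_mono fun ω hω => ?_) hbound
  simp only [Set.mem_ofPred_eq] at hω ⊢
  have h1 : (2 + √2 - ε) * L < m := by
    have h2 : x * ℓ = (2 + √2 - ε) * L + (ε / 2 - τ * x) * L := by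
      rw [hℓdef, hx]
      ring
    have h3 : ε / 4 ≤ ε / 2 - τ * x := by
      have : τ * x ≤ τ * 5 := mul_le_mul_of_nonneg_left (by linarith) hτ0.le
      linarith
    have h4 : ε / 4 * L ≤ (ε / 2 - τ * x) * L := mul_le_mul_of_nonneg_right h3 (by linarith)
    linarith
  exact_mod_cast hω.trans_lt h1

end Asymptotics

theorem one_lt_one_div_measureReal_zero {𝒜 : Type*} [Zero 𝒜] [One 𝒜] (h01 : (0 : 𝒜) ≠ 1)
    [MeasurableSpace 𝒜] [MeasurableSingletonClass 𝒜]
    (μ : Measure 𝒜) [IsProbabilityMeasure μ]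
    (hp0 : 0 < μ.real {0}) (hp1 : 0 < μ.real {1}) : 1 < 1 / μ.real {(0 : 𝒜)} := by
  have h1 : μ.real ({0} ∪ {1}) = μ.real {(0 : 𝒜)} + μ.real {1} :=
    measureReal_union (by simpa using h01) (measurableSet_singleton _)
  have h2 : μ.real ({0} ∪ {1} : Set 𝒜) ≤ 1 := measureReal_le_one
  rw [lt_div_iff₀ hp0]
  linarith

theorem theorem1 {𝒜 : Type*} [Zero 𝒜] [One 𝒜] (h01 : (0 : 𝒜) ≠ 1)
    [MeasurableSpace 𝒜] [MeasurableSingletonClass 𝒜]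
    (μ : Measure 𝒜) [IsProbabilityMeasure μ]
    (hp0 : 0 < μ.real {0}) (hp1 : 0 < μ.real {1})
    (Q : ℝ) (hQ : Q = 1 / μ.real {0})
    {Ω : ℕ → Type*} [∀ n, MeasurableSpace (Ω n)]
    (Pr : ∀ n, Measure (Ω n)) [∀ n, IsProbabilityMeasure (Pr n)]
    (X : ∀ n, Ω n → Matrix (Fin n) (Fin n) 𝒜)
    (hlaw : ∀ n i j, HasLaw (fun ω => X n ω i j) μ (Pr n))
    (hindep : ∀ n, iIndepFun (fun (ij : Fin n × Fin n) ω => X n ω ij.1 ij.2) (Pr n)) :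
    1 < Q ∧
    TendstoInProbability Pr
      (fun n ω => maxSubmatrixSize IsTriangular (X n ω) / Real.logb Q n)
      (2 + √2) ∧
    TendstoInProbability Pr
      (fun n ω => maxSubmatrixSize IsSpecialTriangular (X n ω) / Real.logb Q n)
      (2 + √2) ∧
    TendstoInProbability Pr
      (fun n ω => maxSubmatrixSize IsPermutedTriangular (X n ω) / Real.logb Q n)
      (2 + √2) ∧
    TendstoInProbability Pr
      (fun n ω => maxSubmatrixSize IsPermutedSpecialTriangular (X n ω) / Real.logb Q n)
      (2 + √2) ∧
    ∀ (n : ℕ) (A : Matrix (Fin n) (Fin n) SuperBoolean),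
      SuperBoolean.rank A = maxSubmatrixSize IsPermutedSpecialTriangular A := by
  have hQ1 : 1 < Q := hQ ▸ one_lt_one_div_measureReal_zero h01 μ hp0 hp1
  have hL := tendsto_logb_natCast hQ1
  have hlower := tendsto_measureReal_special_lower_tail hlaw hindep hQ hQ1 hp1
  have hupper := tendsto_measureReal_permuted_upper_tail hlaw hindep hQ hQ1
  refine ⟨hQ1, ?_, ?_, ?_, ?_, fun n A => SuperBoolean.rank_eq_maxSubmatrixSize A⟩ <;>
    refine tendstoInProbability_of_tails hL (fun n ω => maxSubmatrixSize_mono fun m B h => ?_)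
      (fun n ω => maxSubmatrixSize_mono fun m B h => ?_) hlower hupper
  · exact h.isTriangular
  · exact h.isPermutedTriangular
  · exact h
  · exact h.isTriangular.isPermutedTriangular
  · exact h.isTriangular.isPermutedTriangular
  · exact h
  · exact h.isPermutedSpecialTriangular
  · exact h.isPermutedTriangular
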